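/- Fix countably infinite sets of concept names, role names, variables, and abstraction levels. $\mathcal{ALC}$-concepts are built from concept names and $\top$ by $\neg C$, $C\sqcap D$, $C\sqcup D$, $\exists r.C$, $\forall r.C$ ($r$ a role name); $\mathcal{EL}$-concepts use only concept names, $\top$, $C\sqcap D$ and $\exists r.C$. An interpretation has a non-empty domain and interprets concept names as subsets and role names as binary relations, extended to all concepts as usual. A full conjunctive query $q(\bar x)$ is a conjunction of atoms $C(x)$ and $r(x,y)$, with $C$ a (possibly compound) concept and $r$ a role name, all of whose variables occur in the non-empty tuple $\bar x$ of distinct answer variables; $q(\mathcal I)$ is the set of tuples $h(\bar x)$ with $h$ a homomorphism from $q$ to $\mathcal I$. It is connected if the undirected graph on its variables given by its role atoms is connected. For $\mathcal L\in\{\mathcal{ALC},\mathcal{EL}\}$, where all concepts are $\mathcal L$-concepts, an $\mathcal L^{\mathsf{abs}}[\mathrm{ca},\mathrm{cr}]$-ontology is a finite set of labeled concept inclusions $C\sqsubseteq_L D$, concept refinements $L{:}q(\bar x)\ \mathsf{refines}\ L'{:}C$, and concept abstractions $L'{:}C\ \mathsf{abstracts}\ L{:}q(\bar x)$, with $q$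 a full conjunctive query that in abstractions is connected. In $\mathcal L^{\mathsf{abs}}[\mathrm{ca},\mathrm{cr},\mathrm{rr}]$, role refinements $L{:}q(\bar x,\bar y)\ \mathsf{refines}\ L'{:}C_1(x)\wedge r(x,y)\wedge C_2(y)$ are also admitted, with $\bar x$ and $\bar y$ non-empty. Under the DAG semantics, an A-interpretation consists of a set of relevant abstraction levels; a relation $\prec$ on it ($L\prec L'$ meaning that $L$ is finer than $L'$) such that the directed graph of the pairs $(L',L)$ with $L\prec L'$ is acyclic (it need not be a tree); interpretations $\mathcal I_L$, one for each relevant level $L$, with pairwise disjoint domains; and a partial function $\rho$ that assigns to objects $d$ of $\mathcal I_{L'}$ and levels $L\prec L'$ a non-empty tuple $\rho_L(d)$ over the domain of $\mathcal I_L$, such that for all levels $L\prec L'$, each object of $\mathcal I_L$ occurs in $\rho_L(e)$ for at most one object $e$ of $\mathcal I_{L'}$. It satisfies - $C\sqsubseteq_L D$ if $L$ is relevant and $C^{\mathcal I_L}\subseteq D^{\mathcal I_L}$; - $L{:}q(\bar x)\ \mathsf{refines}\ L'{:}C$ if $L\prec L'$ and for every $d\in C^{\mathcal I_{L'}}$,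 $\rho_L(d)$ is defined and in $q(\mathcal I_L)$; - $L'{:}C\ \mathsf{abstracts}\ L{:}q(\bar x)$ if $L\prec L'$ and for every $\bar e\in q(\mathcal I_L)$ there is $d\in C^{\mathcal I_{L'}}$ with $\rho_L(d)=\bar e$; - $L{:}q(\bar x,\bar y)\ \mathsf{refines}\ L'{:}C_1(x)\wedge r(x,y)\wedge C_2(y)$ if $L\prec L'$ and for all $(d_1,d_2)\in r^{\mathcal I_{L'}}$ with $d_1\in C_1^{\mathcal I_{L'}}$ and $d_2\in C_2^{\mathcal I_{L'}}$, $\rho_L(d_1)$ and $\rho_L(d_2)$ are defined and $(\rho_L(d_1),\rho_L(d_2))\in q(\mathcal I_L)$. A model of an ontology is an A-interpretation that satisfies all its statements. Satisfiability under the DAG semantics is the problem to decide, given an ontology $\mathcal O$, a concept $C$ and an abstraction level $L$, whether $\mathcal O$ has a model in which $L$ is relevant and $C^{\mathcal I_L}\neq\emptyset$. Theorem. Under the DAG semantics, satisfiability is undecidable in $\mathcal{ALC}^{\mathsf{abs}}[\mathrm{ca},\mathrm{cr}]$ (with $C$ an $\mathcal{ALC}$-concept) and in $\mathcal{EL}^{\mathsf{abs}}[\mathrm{ca},\mathrm{cr},\mathrm{rr}]$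 (with $C$ an $\mathcal{EL}$-concept). -/

import Mathlib

/-! # Description logics with abstraction and refinement

Concept names, role names, query variables and abstraction levels are all drawn from `ℕ`. -/

namespace AbsDL

/-! ## Roles and concepts -/

/-- Roles: role names `r` and inverse roles `r⁻`. -/
inductive Role where
  | name (r : ℕ) : Role
  | inv (r : ℕ) : Role
  deriving DecidableEq

/-- `ALCI`-concepts.  The concept `⊤` (in the usual sense) is taken as a constructor, so that it is
available in `EL`; the concept `⊥` is `neg top`. -/
inductive Concept where
  | top : Concept
  | name (a : ℕ) : Concept
  | neg (C : Concept) : Concept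
  | inter (C D : Concept) : Concept
  | union (C D : Concept) : Concept
  | ex (R : Role) (C : Concept) : Concept
  | all (R : Role) (C : Concept) : Concept
  deriving DecidableEq

/-- `⊥` -/
abbrev Concept.bot : Concept := .neg .top

/-- Role names, as opposed to inverse roles. -/
def Role.IsName : Role → Prop
  | .name _ => True
  | .inv _ => False

/-- `ALC`-concepts: no inverse roles. -/
def Concept.IsALC : Concept → Prop
  | .top => True
  | .name _ => True
  | .neg C => C.IsALC
  | .inter C D => C.IsALC ∧ D.IsALC
  | .union C D => C.IsALC ∧ D.IsALC
  | .ex R C => R.IsName ∧ C.IsALC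
  | .all R C => R.IsName ∧ C.IsALC

/-- `EL`-concepts: built from `⊤`, concept names, `⊓` and `∃ r . C` with `r` a role name. -/
def Concept.IsEL : Concept → Prop
  | .top => True
  | .name _ => True
  | .neg _ => False
  | .inter C D => C.IsEL ∧ D.IsEL
  | .union _ _ => False
  | .ex R C => R.IsName ∧ C.IsEL
  | .all _ _ => False

/-! ## Interpretations -/

/-- An interpretation of all concept and role names over a non-empty domain. -/
structure Interp where
  Dom : Type
  nonempty : Nonempty Dom
  conc : ℕ → Set Dom
  role : ℕ → Dom → Dom → Prop

def Role.ext (I : Interp) : Role → I.Dom → I.Dom → Prop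
  | .name r => fun d e => I.role r d e
  | .inv r => fun d e => I.role r e d

def Concept.ext (I : Interp) : Concept → Set I.Dom
  | .top => Set.univ
  | .name a => I.conc a
  | .neg C => (C.ext I)ᶜ
  | .inter C D => C.ext I ∩ D.ext I
  | .union C D => C.ext I ∪ D.ext I
  | .ex R C => {d | ∃ e, R.ext I d e ∧ e ∈ C.ext I}
  | .all R C => {d | ∀ e, R.ext I d e → e ∈ C.ext I}

/-! ## Full conjunctive queries -/

/-- Atoms `C(x)` and `r(x, y)` of a conjunctive query, with `r` a role name. -/
inductive Atom where
  | conc (C : Concept) (x : ℕ) : Atom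
  | role (r : ℕ) (x y : ℕ) : Atom
  deriving DecidableEq

/-- A conjunction of atoms.  A full conjunctive query `q(x̄)` consists of such a conjunction together
with a tuple `x̄` of answer variables that contains all variables of the conjunction. -/
abbrev Query := List Atom

def Atom.vars : Atom → List ℕ
  | .conc _ x => [x]
  | .role _ x y => [x, y]

/-- `q(x̄)` is a full conjunctive query: `x̄` consists of distinct variables and no variable is
quantified.  Answer variables `x` that occur in no atom of the list stand for an omitted atom
`⊤(x)`. -/
def Query.IsFull (q : Query) (xs : List ℕ) : Prop :=
  xs.Nodup ∧ ∀ α ∈ q, ∀ x ∈ α.vars, x ∈ xs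

/-- The edges of the undirected graph of a query. -/
def Query.Linked (q : Query) (x y : ℕ) : Prop :=
  ∃ r, Atom.role r x y ∈ q ∨ Atom.role r y x ∈ q

/-- `q(x̄)` is connected. -/
def Query.IsConnected (q : Query) (xs : List ℕ) : Prop :=
  ∀ x ∈ xs, ∀ y ∈ xs, Relation.ReflTransGen q.Linked x y

/-- The atom holds in `I` under the variable assignment `h`. -/
def Atom.Holds (I : Interp) (h : ℕ → I.Dom) : Atom → Prop
  | .conc C x => h x ∈ C.ext I
  | .role r x y => I.role r (h x) (h y)

/-- `h` is a homomorphism from `q` to `I`. -/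
def Query.IsHom (q : Query) (I : Interp) (h : ℕ → I.Dom) : Prop :=
  ∀ α ∈ q, α.Holds I h

/-- The set `q(I)` of answers, for `q = q(x̄)`. -/
def Query.answers (q : Query) (xs : List ℕ) (I : Interp) : Set (List I.Dom) :=
  {es | ∃ h : ℕ → I.Dom, q.IsHom I h ∧ es = xs.map h}

/-- The set `q(I)` of answers, for `q = q(x̄, ȳ)`. -/
def Query.answers₂ (q : Query) (xs ys : List ℕ) (I : Interp) : Set (List I.Dom × List I.Dom) :=
  {p | ∃ h : ℕ → I.Dom, q.IsHom I h ∧ p = (xs.map h, ys.map h)}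

/-! ## Statements and ontologies -/

/-- The statements of an `ALCHI^abs`-ontology. -/
inductive Stmt where
  /-- `C ⊑_L D` -/
  | ci (L : ℕ) (C D : Concept) : Stmt
  /-- `R ⊑_L S` -/
  | ri (L : ℕ) (R S : Role) : Stmt
  /-- `L : q(x̄) refines L' : C` -/
  | cr (L : ℕ) (q : Query) (xs : List ℕ) (L' : ℕ) (C : Concept) : Stmt
  /-- `L' : C abstracts L : q(x̄)` -/
  | ca (L' : ℕ) (C : Concept) (L : ℕ) (q : Query) (xs : List ℕ) : Stmt
  /-- `L : q(x̄, ȳ) refines L' : (C₁(x) ∧ R(x, y) ∧ C₂(y))` -/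
  | rr (L : ℕ) (q : Query) (xs ys : List ℕ) (L' : ℕ) (C₁ : Concept) (R : Role) (C₂ : Concept) : Stmt
  /-- `L' : R abstracts L : q(x̄, ȳ)` -/
  | ra (L' : ℕ) (R : Role) (L : ℕ) (q : Query) (xs ys : List ℕ) : Stmt
  deriving DecidableEq

/-- An ontology is a finite set of statements, presented as a list. -/
abbrev Ontology := List Stmt

/-- The four operators that a fragment may admit. -/
inductive Op where
  | cr | ca | rr | ra
  deriving DecidableEq

/-- A base description logic, given by its concepts, its roles, and whether it has role
inclusions. -/
structure BaseDL where
  concept : Concept → Prop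
  role : Role → Prop
  roleInclusions : Prop

/-- `ALC`: neither inverse roles nor role inclusions. -/
def ALC : BaseDL := ⟨Concept.IsALC, Role.IsName, False⟩

/-- `EL`. -/
def EL : BaseDL := ⟨Concept.IsEL, Role.IsName, False⟩

def Atom.InBase (B : BaseDL) : Atom → Prop
  | .conc C _ => B.concept C
  | .role _ _ _ => True

def Query.InBase (B : BaseDL) (q : Query) : Prop := ∀ α ∈ q, α.InBase B

/-- The statement belongs to the syntax of the fragment `B^abs[ops]`. -/
def Stmt.InFragment (B : BaseDL) (ops : Set Op) : Stmt → Prop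
  | .ci _ C D => B.concept C ∧ B.concept D
  | .ri _ R S => B.roleInclusions ∧ B.role R ∧ B.role S
  | .cr _ q xs _ C => Op.cr ∈ ops ∧ B.concept C ∧ q.InBase B ∧ xs ≠ [] ∧ q.IsFull xs
  | .ca _ C _ q xs =>
      Op.ca ∈ ops ∧ B.concept C ∧ q.InBase B ∧ xs ≠ [] ∧ q.IsFull xs ∧ q.IsConnected xs
  | .rr _ q xs ys _ C₁ R C₂ =>
      Op.rr ∈ ops ∧ B.concept C₁ ∧ B.role R ∧ B.concept C₂ ∧ q.InBase B ∧
        xs ≠ [] ∧ ys ≠ [] ∧ q.IsFull (xs ++ ys)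
  | .ra _ R _ q xs ys =>
      Op.ra ∈ ops ∧ B.role R ∧ q.InBase B ∧
        xs ≠ [] ∧ ys ≠ [] ∧ q.IsFull (xs ++ ys) ∧ q.IsConnected (xs ++ ys)

/-! ## A-interpretations under the DAG semantics -/

/-- A-interpretations, with abstraction levels that form a directed acyclic graph. -/
structure DAGInterp where
  /-- the relevant abstraction levels -/
  levels : Set ℕ
  /-- `prec L L'`: the level `L` is finer than `L'` -/
  prec : ℕ → ℕ → Prop
  prec_mem : ∀ L L', prec L L' → L ∈ levels ∧ L' ∈ levels
  acyclic : ∀ L, ¬ Relation.TransGen prec L L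
  /-- One interpretation per level.  As the domains are indexed by the level, they count as
  pairwise disjoint.  The values at levels outside `levels` play no role. -/
  interp : ℕ → Interp
  /-- The refinement function: `rho L' d L` is `ρ(d, L)`, for `d` an object on level `L'`. -/
  rho : (L' : ℕ) → (interp L').Dom → (L : ℕ) → Option (List (interp L).Dom)
  rho_prec : ∀ L' d L, (rho L' d L).isSome → prec L L'
  rho_ne_nil : ∀ L' d L es, rho L' d L = some es → es ≠ []
  /-- For every coarser level `L'`, an object `d` occurs in the ensemble of at most one object on
  level `L'`. -/
  rho_unique : ∀ L L' (d : (interp L).Dom) (e₁ e₂ : (interp L').Dom) (es₁ es₂),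
    rho L' e₁ L = some es₁ → rho L' e₂ L = some es₂ → d ∈ es₁ → d ∈ es₂ → e₁ = e₂

/-- Satisfaction of statements. -/
def DAGInterp.Satisfies (I : DAGInterp) : Stmt → Prop
  | .ci L C D => L ∈ I.levels ∧ C.ext (I.interp L) ⊆ D.ext (I.interp L)
  | .ri L R S => L ∈ I.levels ∧ ∀ d e, R.ext (I.interp L) d e → S.ext (I.interp L) d e
  | .cr L q xs L' C =>
      I.prec L L' ∧ ∀ d ∈ C.ext (I.interp L'),
        ∃ es ∈ q.answers xs (I.interp L), I.rho L' d L = some es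
  | .ca L' C L q xs =>
      I.prec L L' ∧ ∀ es ∈ q.answers xs (I.interp L),
        ∃ d ∈ C.ext (I.interp L'), I.rho L' d L = some es
  | .rr L q xs ys L' C₁ R C₂ =>
      I.prec L L' ∧ ∀ d₁ d₂, d₁ ∈ C₁.ext (I.interp L') → R.ext (I.interp L') d₁ d₂ →
        d₂ ∈ C₂.ext (I.interp L') →
        ∃ p ∈ q.answers₂ xs ys (I.interp L),
          I.rho L' d₁ L = some p.1 ∧ I.rho L' d₂ L = some p.2
  | .ra L' R L q xs ys =>
      I.prec L L' ∧ ∀ p ∈ q.answers₂ xs ys (I.interp L),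
        ∃ d₁ d₂, R.ext (I.interp L') d₁ d₂ ∧
          I.rho L' d₁ L = some p.1 ∧ I.rho L' d₂ L = some p.2

def DAGInterp.IsModel (I : DAGInterp) (O : Ontology) : Prop := ∀ s ∈ O, I.Satisfies s

/-- `C` is `L`-satisfiable with respect to `O` under the DAG semantics. -/
def SatisfiableDAG (O : Ontology) (C : Concept) (L : ℕ) : Prop :=
  ∃ I : DAGInterp, I.IsModel O ∧ L ∈ I.levels ∧ (C.ext (I.interp L)).Nonempty

/-! ## Gödel numberings

Inputs to decision procedures are coded by natural numbers, through bijections. -/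

def Role.equivSum : Role ≃ ℕ ⊕ ℕ where
  toFun
    | .name r => .inl r
    | .inv r => .inr r
  invFun
    | .inl r => .name r
    | .inr r => .inv r
  left_inv R := by cases R <;> rfl
  right_inv s := by cases s <;> rfl

instance : Denumerable Role := Denumerable.ofEquiv _ Role.equivSum

def Concept.encodeNat : Concept → ℕ
  | .top => 0
  | .name a => 6 * a + 1
  | .neg C => 6 * C.encodeNat + 2
  | .inter C D => 6 * Nat.pair C.encodeNat D.encodeNat + 3
  | .union C D => 6 * Nat.pair C.encodeNat D.encodeNat + 4
  | .ex R C => 6 * Nat.pair (Encodable.encode R) C.encodeNat + 5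
  | .all R C => 6 * Nat.pair (Encodable.encode R) C.encodeNat + 6

def Concept.decodeNat : ℕ → Concept
  | 0 => .top
  | n + 1 =>
    have h : n / 6 < n + 1 := Nat.lt_succ_of_le (Nat.div_le_self n 6)
    have _h₁ : (n / 6).unpair.1 < n + 1 := lt_of_le_of_lt (Nat.unpair_left_le _) h
    have _h₂ : (n / 6).unpair.2 < n + 1 := lt_of_le_of_lt (Nat.unpair_right_le _) h
    match n % 6 with
    | 0 => .name (n / 6)
    | 1 => .neg (decodeNat (n / 6))
    | 2 => .inter (decodeNat (n / 6).unpair.1) (decodeNat (n / 6).unpair.2)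
    | 3 => .union (decodeNat (n / 6).unpair.1) (decodeNat (n / 6).unpair.2)
    | 4 => .ex (Denumerable.ofNat Role (n / 6).unpair.1) (decodeNat (n / 6).unpair.2)
    | _ => .all (Denumerable.ofNat Role (n / 6).unpair.1) (decodeNat (n / 6).unpair.2)

theorem Concept.decodeNat_encodeNat (C : Concept) : decodeNat C.encodeNat = C := by
  induction C with
  | top => simp [encodeNat, decodeNat]
  | name a =>
    simp [encodeNat, decodeNat]
  | neg C ih =>
    have h1 : ∀ m, (6 * m + 1) % 6 = 1 := by omega
    have h2 : ∀ m, (6 * m + 1) / 6 = m := by omega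
    simp [encodeNat, decodeNat, h1, h2, ih]
  | inter C D ihC ihD =>
    have h1 : ∀ m, (6 * m + 2) % 6 = 2 := by omega
    have h2 : ∀ m, (6 * m + 2) / 6 = m := by omega
    simp [encodeNat, decodeNat, h1, h2, ihC, ihD]
  | union C D ihC ihD =>
    have h1 : ∀ m, (6 * m + 3) % 6 = 3 := by omega
    have h2 : ∀ m, (6 * m + 3) / 6 = m := by omega
    simp [encodeNat, decodeNat, h1, h2, ihC, ihD]
  | ex R C ih =>
    have h1 : ∀ m, (6 * m + 4) % 6 = 4 := by omega
    have h2 : ∀ m, (6 * m + 4) / 6 = m := by omega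
    simp only [encodeNat, decodeNat, h1, h2, Nat.unpair_pair, Denumerable.ofNat_encode, ih]
  | all R C ih =>
    have h1 : ∀ m, (6 * m + 5) % 6 = 5 := by omega
    have h2 : ∀ m, (6 * m + 5) / 6 = m := by omega
    simp only [encodeNat, decodeNat, h1, h2, Nat.unpair_pair, Denumerable.ofNat_encode, ih]

theorem Concept.encodeNat_decodeNat (n : ℕ) : (decodeNat n).encodeNat = n := by
  induction n using Nat.strong_induction_on with
  | _ n ih =>
    cases n with
    | zero => simp [encodeNat, decodeNat]
    | succ n =>
      have h : n / 6 < n + 1 := Nat.lt_succ_of_le (Nat.div_le_self n 6)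
      have h₁ : (n / 6).unpair.1 < n + 1 := lt_of_le_of_lt (Nat.unpair_left_le _) h
      have h₂ : (n / 6).unpair.2 < n + 1 := lt_of_le_of_lt (Nat.unpair_right_le _) h
      have i0 := ih _ h
      have i1 := ih _ h₁
      have i2 := ih _ h₂
      have hp := Nat.pair_unpair (n / 6)
      rw [decodeNat]
      split <;> simp only [encodeNat, i0, i1, i2, hp, Denumerable.encode_ofNat]
      case h_6 _ n0 n1 n2 n3 n4 =>
        have m0 : n % 6 ≠ 0 := n0
        have m1 : n % 6 ≠ 1 := n1
        have m2 : n % 6 ≠ 2 := n2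
        have m3 : n % 6 ≠ 3 := n3
        have m4 : n % 6 ≠ 4 := n4
        omega
      all_goals omega

instance : Denumerable Concept :=
  Denumerable.mk' ⟨Concept.encodeNat, Concept.decodeNat,
    Concept.decodeNat_encodeNat, Concept.encodeNat_decodeNat⟩

def Atom.equivSum : Atom ≃ (Concept × ℕ) ⊕ (ℕ × ℕ × ℕ) where
  toFun
    | .conc C x => .inl (C, x)
    | .role r x y => .inr (r, x, y)
  invFun
    | .inl (C, x) => .conc C x
    | .inr (r, x, y) => .role r x y
  left_inv α := by cases α <;> rfl
  right_inv s := by rcases s with ⟨_, _⟩ | ⟨_, _, _⟩ <;> rfl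

instance : Denumerable Atom := Denumerable.ofEquiv _ Atom.equivSum

def Stmt.equivSum : Stmt ≃
    (ℕ × Concept × Concept) ⊕ (ℕ × Role × Role) ⊕
    (ℕ × List Atom × List ℕ × ℕ × Concept) ⊕
    (ℕ × Concept × ℕ × List Atom × List ℕ) ⊕
    (ℕ × List Atom × List ℕ × List ℕ × ℕ × Concept × Role × Concept) ⊕
    (ℕ × Role × ℕ × List Atom × List ℕ × List ℕ) where
  toFun
    | .ci L C D => .inl (L, C, D)
    | .ri L R S => .inr (.inl (L, R, S))
    | .cr L q xs L' C => .inr (.inr (.inl (L, q, xs, L', C)))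
    | .ca L' C L q xs => .inr (.inr (.inr (.inl (L', C, L, q, xs))))
    | .rr L q xs ys L' C₁ R C₂ => .inr (.inr (.inr (.inr (.inl (L, q, xs, ys, L', C₁, R, C₂)))))
    | .ra L' R L q xs ys => .inr (.inr (.inr (.inr (.inr (L', R, L, q, xs, ys)))))
  invFun
    | .inl (L, C, D) => .ci L C D
    | .inr (.inl (L, R, S)) => .ri L R S
    | .inr (.inr (.inl (L, q, xs, L', C))) => .cr L q xs L' C
    | .inr (.inr (.inr (.inl (L', C, L, q, xs)))) => .ca L' C L q xs
    | .inr (.inr (.inr (.inr (.inl (L, q, xs, ys, L', C₁, R, C₂))))) => .rr L q xs ys L' C₁ R C₂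
    | .inr (.inr (.inr (.inr (.inr (L', R, L, q, xs, ys))))) => .ra L' R L q xs ys
  left_inv s := by cases s <;> rfl
  right_inv s := by
    rcases s with ⟨_, _, _⟩ | ⟨_, _, _⟩ | ⟨_, _, _, _, _⟩ | ⟨_, _, _, _, _⟩ |
      ⟨_, _, _, _, _, _, _, _⟩ | ⟨_, _, _, _, _, _⟩ <;> rfl

instance : Denumerable Stmt := Denumerable.ofEquiv _ Stmt.equivSum

/-! ## The decision problem -/

/-- Inputs to the satisfiability problem. -/
abbrev Input := Ontology × Concept × ℕ

/-- The input consists of a `B^abs[ops]`-ontology, a `B`-concept, and an abstraction level. -/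
def Input.InFragment (B : BaseDL) (ops : Set Op) (i : Input) : Prop :=
  (∀ s ∈ i.1, s.InFragment B ops) ∧ B.concept i.2.1

/-- Satisfiability in `B^abs[ops]` under the DAG semantics is decidable: some algorithm answers
correctly on all inputs from the fragment.  On other inputs it may answer anything. -/
def DAGSatDecidable (B : BaseDL) (ops : Set Op) : Prop :=
  ∃ f : Input → Bool, Computable f ∧
    ∀ i : Input, Input.InFragment B ops i → (f i = true ↔ SatisfiableDAG i.1 i.2.1 i.2.2)

end AbsDL

/-! ## A fixed Turing machine with undecidable halting problem -/

namespace Turing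

open StateTransition

/-! The problem is already undecidable in `EL` with `ca` and `cr` only; both claims follow because
fragments are monotone. The reduction is from non-halting of a fixed Turing machine
(`exists_TM0_halting_undecidable`), replayed as a system with two stacks (`eval_dom_iff_reach`).

The ontology makes level 1 contain a homomorphic image of the graph of all pairs of stacks, whose
edges are the pushes and their inverses. Concept inclusions place the start state at the node of the
input and propagate states along the edges, one inclusion per instruction. No concept can be
declared empty in `EL`; halting states are excluded by demanding two ensembles of different lengths
on level 0. Hence the start concept is satisfiable iff no halting state is reachable
(`satisfiable_ontology_iff`).

The difficulty is that pushes to different stacks must commute. For each open square, an abstraction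
creates an object whose ensemble is this square, and a refinement of the same object supplies the
missing edges. Ensembles have to be disjoint, while neighbouring squares overlap. Here the DAG
semantics enters: level 1 may lie below many levels at once, and disjointness is required for each
coarser level separately. One level from 2 upwards is used for every choice of two letters and a
colour, the colour being the parities of the two stack heights. Squares that share a level are then
disjoint (`Stacks.eq_of_mem_square`), so the full grid is a model; conversely every model contains
the grid (`exists_grid`). -/

theorem eval_dom_iff {σ : Type*} (f : σ → Option σ) (a : σ) :
    (StateTransition.eval f a).Dom ↔ ∃ b, StateTransition.Reaches f a b ∧ f b = none := by
  rw [Part.dom_iff_mem]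
  exact exists_congr fun b => mem_eval

/-- Restriction of a `TM0` machine to a finite set of supporting states. -/
theorem TM0.exists_finite_of_supports {Γ Λ : Type} [Inhabited Γ] [Inhabited Λ]
    (M : TM0.Machine Γ Λ) (S : Finset Λ) (hS : TM0.Supports M (S : Set Λ)) :
    ∃ (_ : Inhabited S) (M' : TM0.Machine Γ S), ∀ l, (TM0.eval M' l).Dom ↔ (TM0.eval M l).Dom := by
  classical
  let _ : Inhabited S := ⟨⟨default, hS.1⟩⟩
  let idp : PointedMap Γ Γ := ⟨id, rfl⟩
  -- States outside `S` are never visited, so their image is irrelevant.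
  let g₁ : PointedMap Λ S :=
    ⟨fun q => if h : q ∈ S then ⟨q, h⟩ else default, by
      have : (default : Λ) ∈ S := hS.1
      simp only [this, dif_pos]; rfl⟩
  refine ⟨inferInstance, M.map idp idp g₁ Subtype.val, fun l => ?_⟩
  have hg : ∀ q ∈ (S : Set Λ), (g₁ q : Λ) = q := by
    intro q hq
    have : q ∈ S := hq
    simp [g₁, this]
  have hr := TM0.Machine.map_respects M idp idp g₁ Subtype.val hS (fun _ => rfl) hg
  refine StateTransition.tr_eval_dom hr (a₁ := TM0.init l) ⟨hS.1, ?_⟩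
  rw [TM0.map_init idp g₁ l]
  simp [idp]

instance PartrecToTM2.K'.fintype : Fintype PartrecToTM2.K' :=
  ⟨{.main, .rev, .aux, .stack}, fun k => by cases k <;> simp⟩

/-- The digit `b` in the alphabet of `PartrecToTM2`. -/
def PartrecToTM2.bit (b : Bool) : PartrecToTM2.Γ' := cond b .bit1 .bit0

/-- Serves to write the input tape in terms of `Nat.bits`, which `primrec_bits` shows to be
primitive recursive. -/
theorem PartrecToTM2.trNat_eq (n : ℕ) : trNat n = n.bits.map bit := by
  have hpos : ∀ p : PosNum, trPosNum p = (p : ℕ).bits.map bit := by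
    intro p
    induction p with
    | one => simp [trPosNum, bit]
    | bit0 p ih =>
      have h0 : (p : ℕ) ≠ 0 := (PosNum.cast_pos p).ne'
      rw [trPosNum, PosNum.cast_bit0, ← two_mul, Nat.bit0_bits _ h0, ih]
      rfl
    | bit1 p ih =>
      rw [trPosNum, PosNum.cast_bit1, ← two_mul, Nat.bit1_bits, ih]
      rfl
  rw [trNat]
  have key : ∀ m : Num, trNum m = (m : ℕ).bits.map bit := by
    intro m
    cases m with
    | zero => simp [trNum]
    | pos p => exact hpos p
  rw [key, Num.to_of_nat]

/-- Course-of-values recursion: the bits of `n > 0` are its parity followed by the bits of `n / 2`.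
The list `l` of earlier values has length `n`, so `n` is recovered as `l.length`. -/
theorem primrec_bits : Primrec Nat.bits := by
  have hg : Primrec₂ fun (_ : Unit) (l : List (List Bool)) =>
      if l.length = 0 then some [] else
        (l[l.length / 2]?).map fun t => (decide (l.length % 2 = 1)) :: t := by
    have hlen : Primrec fun p : Unit × List (List Bool) => p.2.length :=
      Primrec.list_length.comp Primrec.snd
    refine Primrec.ite (Primrec.eq.comp hlen (Primrec.const 0)) (Primrec.const _) ?_
    refine Primrec.option_map
      (Primrec.list_getElem?.comp Primrec.snd (Primrec.nat_div.comp hlen (Primrec.const 2))) ?_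
    refine Primrec.list_cons.comp ?_ Primrec.snd
    exact (Primrec.eq.comp (Primrec.nat_mod.comp (hlen.comp Primrec.fst) (Primrec.const 2))
      (Primrec.const 1)).decide
  have h := Primrec.nat_strong_rec (fun (_ : Unit) (n : ℕ) => n.bits) hg (by
    intro _ n
    rcases Nat.eq_zero_or_pos n with rfl | hn
    · simp
    · have hlt : n / 2 < n := Nat.div_lt_self hn (by norm_num)
      simp only [List.length_map, List.length_range, hn.ne', if_false, List.getElem?_map,
        List.getElem?_range hlt, Option.map_some, Option.some_inj]
      rcases Nat.even_or_odd' n with ⟨m, rfl | rfl⟩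
      · have hm : m ≠ 0 := by omega
        rw [Nat.bit0_bits _ hm, show 2 * m / 2 = m by omega]
        simp
      · rw [Nat.bit1_bits, show (2 * m + 1) / 2 = m by omega]
        simp)
  exact h.comp (Primrec.const ()) Primrec.id

/-- A code for the universal function `f`, which runs the `n`-th program on input 0, inherits the
undecidability of halting on input 0. -/
theorem exists_code_halting_undecidable :
    ∃ c : ToPartrec.Code, ¬ ComputablePred fun n : ℕ => (c.eval [n]).Dom := by
  open Nat.Partrec in
  let f : ℕ →. ℕ := fun n => Code.eval (Denumerable.ofNat Code n) 0
  have hf : Nat.Partrec f :=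
    Partrec.nat_iff.1 (Code.eval_part.comp (Computable.ofNat Code) (Computable.const 0))
  obtain ⟨c, hc⟩ := ToPartrec.Code.exists_code (Nat.Partrec'.part_iff₁.2 (Partrec.nat_iff.2 hf))
  refine ⟨c, fun h => ComputablePred.halting_problem 0 ?_⟩
  have h' : ComputablePred fun d : Code => (c.eval [Encodable.encode d]).Dom :=
    ComputablePred.computable_iff.2 <| by
      obtain ⟨g, hg, e⟩ := ComputablePred.computable_iff.1 h
      refine ⟨fun d => g (Encodable.encode d), hg.comp Computable.encode, ?_⟩
      funext d
      exact congrFun e (Encodable.encode d)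
  refine h'.of_eq fun d => ?_
  have := hc ⟨[Encodable.encode d], rfl⟩
  simp only at this
  rw [this]
  simp [f, List.Vector.head, Part.map_eq_map]

/-- There is a Turing machine with finitely many states and symbols whose halting problem is
undecidable. -/
theorem exists_TM0_halting_undecidable :
    ∃ (Γ Λ : Type) (_ : Fintype Γ) (_ : Inhabited Γ) (_ : Fintype Λ) (_ : Inhabited Λ)
      (M : TM0.Machine Γ Λ) (inp : ℕ → List Γ),
      (∀ e : Γ → ℕ, Computable fun n => (inp n).map e) ∧
      ¬ ComputablePred fun n => (TM0.eval M (inp n)).Dom := by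
  classical
  open PartrecToTM2 in
  obtain ⟨c, hc⟩ := exists_code_halting_undecidable
  -- Machines start in the default state; this choice builds the program `c` into the machine.
  let _ : Inhabited Λ' := ⟨trNormal c Cont'.halt⟩
  have s2 : TM2.Supports PartrecToTM2.tr (codeSupp c Cont'.halt) := tr_supports c Cont'.halt
  have s1 := TM2to1.tr_supports PartrecToTM2.tr s2
  have s0 := TM1to0.tr_supports _ s1
  obtain ⟨_, M, hM⟩ := TM0.exists_finite_of_supports _ _ s0
  refine ⟨_, _, inferInstance, inferInstance, inferInstance, inferInstance, M,
    fun n => TM2to1.trInit K'.main (trList [n]), fun e => ?_, ?_⟩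
  -- The input occupies the track of the stack `main`, bottom first: the separator `cons`, flagged
  -- `true` as the bottom cell, then the bits of `n` from the most significant one.
  · let s : Option Γ' → ∀ _ : K', Option Γ' := fun a => Function.update (fun _ => none) K'.main a
    have : ∀ n, (TM2to1.trInit (Γ := fun _ : K' => Γ') K'.main (trList [n])).map e =
        e (true, s (some .cons)) :: n.bits.reverse.map fun b =>
          cond b (e (false, s (some .bit1))) (e (false, s (some .bit0))) := by
      intro n
      have hrev : (trList [n]).reverse = .cons :: n.bits.reverse.map bit := by
        simp [trNat_eq]
      rw [TM2to1.trInit, hrev]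
      change _ :: List.map e (List.map _ (List.map bit n.bits.reverse)) = _
      have hmap : ∀ {α β γ δ : Type} (f : α → β) (g : β → γ) (h : γ → δ) (l : List α),
          ((l.map f).map g).map h = l.map fun x => h (g (f x)) := by simp
      refine congrArg₂ _ rfl ((hmap _ _ _ _).trans (List.map_congr_left fun b _ => ?_))
      cases b <;> rfl
    refine Computable.of_eq (Primrec.to_comp ?_) fun n => (this n).symm
    refine Primrec.list_cons.comp (Primrec.const _) (Primrec.list_map
      (Primrec.list_reverse.comp primrec_bits) ?_)
    exact Primrec.cond Primrec.snd (Primrec.const _) (Primrec.const _)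
  · intro h
    refine hc (h.of_eq fun n => ?_)
    refine (hM _).trans (Iff.trans (by rw [TM1to0.tr_eval])
      ((TM2to1.tr_eval_dom PartrecToTM2.tr K'.main (trList [n])).trans ?_))
    have hi : (TM2.init K'.main (trList [n]) : TM2.Cfg (fun _ : K' => Γ') Λ' (Option Γ')) =
        PartrecToTM2.init c [n] := by
      simp only [TM2.init, PartrecToTM2.init]
      congr 1
      funext k
      cases k <;> rfl
    have := PartrecToTM2.tr_eval c [n]
    rw [← hi] at this
    change (StateTransition.eval (TM2.step PartrecToTM2.tr) _).Dom ↔ _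
    rw [this]
    rfl

end Turing

/-! ## Two-stack systems -/

namespace TwoStack

/-- Instructions of a nondeterministic system with states `P` and two stacks over `Γ`; the stacks
are named by Booleans. -/
inductive Instr (P Γ : Type) where
  | nop (p p' : P) : Instr P Γ
  | push (i : Bool) (a : Γ) (p p' : P) : Instr P Γ
  | pop (i : Bool) (a : Γ) (p p' : P) : Instr P Γ
  | empty (i : Bool) (p p' : P) : Instr P Γ

variable {P Γ : Type}

/-- The contents of a pair of stacks. -/
abbrev Stacks (Γ : Type) := List Γ × List Γ

/-- Push the letter `a` to the stack `i`. -/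
def Stacks.push (i : Bool) (a : Γ) (s : Stacks Γ) : Stacks Γ :=
  cond i (s.1, a :: s.2) (a :: s.1, s.2)

/-- The stack `i`. -/
def Stacks.get (i : Bool) (s : Stacks Γ) : List Γ := cond i s.2 s.1

/-- Reachability from the state `p₀` with stack contents `s₀`. -/
inductive Reach (M : List (Instr P Γ)) (p₀ : P) (s₀ : Stacks Γ) : P → Stacks Γ → Prop where
  | refl : Reach M p₀ s₀ p₀ s₀
  | nop {p p' s} : .nop p p' ∈ M → Reach M p₀ s₀ p s → Reach M p₀ s₀ p' s
  | push {i a p p' s} : .push i a p p' ∈ M → Reach M p₀ s₀ p s → Reach M p₀ s₀ p' (s.push i a)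
  | pop {i a p p' s} : .pop i a p p' ∈ M → Reach M p₀ s₀ p (s.push i a) → Reach M p₀ s₀ p' s
  | empty {i p p' s} : .empty i p p' ∈ M → s.get i = [] → Reach M p₀ s₀ p s → Reach M p₀ s₀ p' s

end TwoStack

/-! ### Simulation of a Turing machine by a two-stack system -/

namespace TwoStack

open Turing

variable {Γ Λ : Type}

/-- States of the simulation of a Turing machine: either the head symbol is known, or it has to be
fetched from the stack that stands for the left (`false`) or right (`true`) part of the tape. -/
abbrev SimState (Γ Λ : Type) := Λ × (Γ ⊕ Bool)

/-- The instructions for one transition of the Turing machine. -/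
def simStep (q : Λ) (a : Γ) : Option (Λ × TM0.Stmt Γ) → List (Instr (SimState Γ Λ) Γ)
  | none => []
  | some (q', .write b) => [.nop (q, .inl a) (q', .inl b)]
  | some (q', .move .left) => [.push true a (q, .inl a) (q', .inr false)]
  | some (q', .move .right) => [.push false a (q, .inl a) (q', .inr true)]

section Halting

variable [Fintype Γ] [Fintype Λ] [Inhabited Λ]

open Classical in
/-- The halting states of the simulation. -/
noncomputable def simHalting (M : TM0.Machine Γ Λ) : List (SimState Γ Λ) :=
  Finset.univ.toList.filter fun p => ∃ q a, p = (q, .inl a) ∧ M q a = none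

theorem mem_simHalting_iff {M : TM0.Machine Γ Λ} {p : SimState Γ Λ} :
    p ∈ simHalting M ↔ ∃ q a, p = (q, .inl a) ∧ M q a = none := by
  simp [simHalting]

end Halting

variable [Inhabited Γ]

/-- The configuration of the Turing machine that is represented by a configuration of the
simulation. -/
def simCfg : SimState Γ Λ → Stacks Γ → TM0.Cfg Γ Λ
  | (q, .inl a), s => ⟨q, ⟨a, .mk s.1, .mk s.2⟩⟩
  | (q, .inr false), s => ⟨q, ⟨(ListBlank.mk s.1).head, (ListBlank.mk s.1).tail, .mk s.2⟩⟩
  | (q, .inr true), s => ⟨q, ⟨(ListBlank.mk s.2).head, .mk s.1, (ListBlank.mk s.2).tail⟩⟩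

/-- Fetching moves a letter from a stack to the head and is invisible on the tape. -/
theorem simCfg_pop (q : Λ) (i : Bool) (a : Γ) (s : Stacks Γ) :
    simCfg (q, .inl a) s = simCfg (q, .inr i) (s.push i a) := by
  cases i <;> simp [simCfg, Stacks.push]

/-- An empty stack stands for a blank half-tape, so the default symbol is fetched. -/
theorem simCfg_empty (q : Λ) (i : Bool) (s : Stacks Γ) (h : s.get i = []) :
    simCfg (q, .inl (default : Γ)) s = simCfg (q, .inr i) s := by
  obtain ⟨u, v⟩ := s
  cases i <;> simp only [Stacks.get, cond_true, cond_false] at h <;> subst h <;> rfl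

variable [Inhabited Λ]

theorem step_simCfg {M : TM0.Machine Γ Λ} {q : Λ} {a : Γ} {s : Stacks Γ} :
    TM0.step M (simCfg (q, .inl a) s) = (M q a).map fun r => match r with
      | (q', .write b) => simCfg (q', .inl b) s
      | (q', .move .left) => simCfg (q', .inr false) (s.push true a)
      | (q', .move .right) => simCfg (q', .inr true) (s.push false a) := by
  simp only [TM0.step, simCfg]
  rcases M q a with _ | ⟨q', (_ | _) | b⟩ <;> simp [Tape.move, Tape.write, Stacks.push]

variable [Fintype Γ] [Fintype Λ]

/-- Fetching of the head symbol. -/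
noncomputable def simFetch (q : Λ) (i : Bool) : List (Instr (SimState Γ Λ) Γ) :=
  .empty i (q, .inr i) (q, .inl default) ::
    Finset.univ.toList.map fun a => .pop i a (q, .inr i) (q, .inl a)

/-- The two-stack system that simulates a Turing machine. -/
noncomputable def sim (M : TM0.Machine Γ Λ) : List (Instr (SimState Γ Λ) Γ) :=
  Finset.univ.toList.flatMap fun q =>
    (simFetch q false ++ simFetch q true) ++ Finset.univ.toList.flatMap fun a => simStep q a (M q a)

theorem mem_sim_iff {M : TM0.Machine Γ Λ} {I : Instr (SimState Γ Λ) Γ} :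
    I ∈ sim M ↔ (∃ q i, I = .empty i (q, .inr i) (q, .inl default)) ∨
      (∃ q i a, I = .pop i a (q, .inr i) (q, .inl a)) ∨ ∃ q a, I ∈ simStep q a (M q a) := by
  simp only [sim, simFetch, List.mem_flatMap, Finset.mem_toList, Finset.mem_univ, true_and,
    List.mem_append, List.mem_cons, List.mem_map, Bool.exists_bool, exists_or, eq_comm (b := I)]
  rw [or_or_or_comm, or_assoc]

/-- `nop` and `push` instructions match machine steps, while `pop` and `empty` are fetches that
leave the represented configuration unchanged. The start state is a pending fetch from the right
stack, which represents the head on the first letter of `l`. -/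
theorem reaches_of_reach {M : TM0.Machine Γ Λ} {l : List Γ} {p : SimState Γ Λ} {s : Stacks Γ}
    (h : Reach (sim M) (default, .inr true) ([], l) p s) :
    StateTransition.Reaches (TM0.step M) (TM0.init l) (simCfg p s) := by
  induction h with
  | refl => exact .refl
  | nop hI _ ih =>
    rcases mem_sim_iff.1 hI with ⟨q, i, h⟩ | ⟨q, i, a, h⟩ | ⟨q, a, h⟩
    · cases h
    · cases h
    · rcases e : M q a with _ | ⟨q', (_ | _) | b⟩ <;> simp [e, simStep] at h
      obtain ⟨rfl, rfl⟩ := h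
      exact ih.tail (by simp [step_simCfg, e])
  | push hI _ ih =>
    rcases mem_sim_iff.1 hI with ⟨q, i, h⟩ | ⟨q, i, a, h⟩ | ⟨q, a, h⟩
    · cases h
    · cases h
    · rcases e : M q a with _ | ⟨q', (_ | _) | b⟩ <;> simp [e, simStep] at h <;>
      · obtain ⟨rfl, rfl, rfl, rfl⟩ := h
        exact ih.tail (by simp [step_simCfg, e])
  | pop hI _ ih =>
    rcases mem_sim_iff.1 hI with ⟨q, i, h⟩ | ⟨q, i, a, h⟩ | ⟨q, a, h⟩
    · cases h
    · cases h
      rwa [simCfg_pop]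
    · rcases e : M q a with _ | ⟨q', (_ | _) | b⟩ <;> simp [e, simStep] at h
  | empty hI hs _ ih =>
    rcases mem_sim_iff.1 hI with ⟨q, i, h⟩ | ⟨q, i, a, h⟩ | ⟨q, a, h⟩
    · cases h
      rwa [simCfg_empty _ _ _ hs]
    · cases h
    · rcases e : M q a with _ | ⟨q', (_ | _) | b⟩ <;> simp [e, simStep] at h

theorem Reach.fetch {M : TM0.Machine Γ Λ} {p₀ : SimState Γ Λ} {s₀ s : Stacks Γ} {q : Λ} {i : Bool}
    (h : Reach (sim M) p₀ s₀ (q, .inr i) s) :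
    ∃ a s', Reach (sim M) p₀ s₀ (q, .inl a) s' ∧ simCfg (q, .inl a) s' = simCfg (q, .inr i) s := by
  by_cases hs : s.get i = []
  · exact ⟨default, s, .empty (mem_sim_iff.2 (.inl ⟨q, i, rfl⟩)) hs h, simCfg_empty _ _ _ hs⟩
  · obtain ⟨a, s', rfl⟩ : ∃ a s', s = Stacks.push i a s' := by
      obtain ⟨u, v⟩ := s
      cases i
      · obtain ⟨a, u, rfl⟩ := List.exists_cons_of_ne_nil hs
        exact ⟨a, (u, v), rfl⟩
      · obtain ⟨a, v, rfl⟩ := List.exists_cons_of_ne_nil hs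
        exact ⟨a, (u, v), rfl⟩
    exact ⟨a, s', .pop (mem_sim_iff.2 (.inr (.inl ⟨q, i, a, rfl⟩))) h, simCfg_pop _ _ _ _⟩

/-- A move leaves a pending fetch, which `Reach.fetch` completes, so that the head symbol is known
before the next step. -/
theorem exists_reach_of_reaches {M : TM0.Machine Γ Λ} {l : List Γ} {c : TM0.Cfg Γ Λ}
    (h : StateTransition.Reaches (TM0.step M) (TM0.init l) c) :
    ∃ q a s, Reach (sim M) (default, .inr true) ([], l) (q, .inl a) s ∧
      simCfg (q, .inl a) s = c := by
  induction h with
  | refl =>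
    obtain ⟨a, s, h, e⟩ := Reach.fetch (M := M) (s := ([], l)) .refl
    exact ⟨_, a, s, h, e⟩
  | tail _ hc ih =>
    obtain ⟨q, a, s, h, rfl⟩ := ih
    rw [Option.mem_def, step_simCfg] at hc
    rcases e : M q a with _ | ⟨q', (_ | _) | b⟩ <;>
      simp only [e, Option.map_none, Option.map_some, Option.some_inj, reduceCtorEq] at hc <;>
      subst hc
    · obtain ⟨a', s', h', e'⟩ := Reach.fetch (.push (i := true) (a := a) (p' := (q', .inr false))
        (mem_sim_iff.2 (.inr (.inr ⟨q, a, by simp [e, simStep]⟩))) h)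
      exact ⟨_, a', s', h', e'⟩
    · obtain ⟨a', s', h', e'⟩ := Reach.fetch (.push (i := false) (a := a) (p' := (q', .inr true))
        (mem_sim_iff.2 (.inr (.inr ⟨q, a, by simp [e, simStep]⟩))) h)
      exact ⟨_, a', s', h', e'⟩
    · exact ⟨q', b, s, .nop (mem_sim_iff.2 (.inr (.inr ⟨q, a, by simp [e, simStep]⟩))) h, rfl⟩

/-- The Turing machine halts iff the two-stack system reaches a halting state. -/
theorem eval_dom_iff_reach (M : TM0.Machine Γ Λ) (l : List Γ) :
    (TM0.eval M l).Dom ↔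
      ∃ p ∈ simHalting M, ∃ s, Reach (sim M) (default, .inr true) ([], l) p s := by
  have hd : (TM0.eval M l).Dom ↔ (StateTransition.eval (TM0.step M) (TM0.init l)).Dom := Iff.rfl
  rw [hd, Turing.eval_dom_iff]
  constructor
  · rintro ⟨c, hc, hn⟩
    obtain ⟨q, a, s, h, rfl⟩ := exists_reach_of_reaches hc
    rw [step_simCfg, Option.map_eq_none_iff] at hn
    exact ⟨_, mem_simHalting_iff.2 ⟨q, a, rfl, hn⟩, s, h⟩
  · rintro ⟨p, hp, s, h⟩
    obtain ⟨q, a, rfl, hn⟩ := mem_simHalting_iff.1 hp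
    exact ⟨_, reaches_of_reach h, by rw [step_simCfg, hn]; rfl⟩

end TwoStack

/-! ## Two-stack systems as ontologies -/

namespace TwoStack

open AbsDL Encodable

section Stacks

variable {Γ : Type}

/-- A colour consists of two bits. -/
abbrev Color := Bool × Bool

/-- Flip the bit `i`. -/
def Color.flip (i : Bool) (c : Color) : Color := cond i (c.1, !c.2) (!c.1, c.2)

/-- The parities of the stack heights. -/
def Stacks.color (s : Stacks Γ) : Color := (s.1.length.bodd, s.2.length.bodd)

theorem Stacks.color_nil : Stacks.color (([], []) : Stacks Γ) = (false, false) := by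
  simp [Stacks.color]

theorem Stacks.color_push (i : Bool) (a : Γ) (s : Stacks Γ) :
    (s.push i a).color = s.color.flip i := by
  cases i <;> simp [Stacks.push, Stacks.color, Color.flip]

theorem Stacks.get_push_not (i : Bool) (a : Γ) (s : Stacks Γ) :
    (s.push i a).get (!i) = s.get (!i) := by
  cases i <;> simp [Stacks.push, Stacks.get]

/-- The square with lower left corner `s`. -/
def Stacks.square (a b : Γ) (s : Stacks Γ) : List (Stacks Γ) :=
  [s, s.push false a, (s.push false a).push true b, s.push true b]

/-- Distinct squares whose lower left corners have the same colour are disjoint. -/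
theorem Stacks.eq_of_mem_square {a b : Γ} {s t x : Stacks Γ} (hc : s.color = t.color)
    (hs : x ∈ s.square a b) (ht : x ∈ t.square a b) : s = t := by
  obtain ⟨u, v⟩ := s
  obtain ⟨u', v'⟩ := t
  simp only [Stacks.color, Prod.mk.injEq] at hc
  obtain ⟨h1, h2⟩ := hc
  simp only [Stacks.square, Stacks.push, cond_false, cond_true, List.mem_cons, List.not_mem_nil,
    or_false] at hs ht
  -- On each stack, `x` either agrees with a corner or extends it by the fixed letter. If the two
  -- squares differ in this respect, the corners' heights differ by one, against equal parity;
  -- otherwise the corners agree.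
  rcases hs with rfl | rfl | rfl | rfl <;> rcases ht with e | e | e | e <;>
    simp only [Prod.mk.injEq, List.cons.injEq, true_and] at e <;> obtain ⟨e1, e2⟩ := e <;>
    first
    | (subst e1 e2; rfl)
    | (subst e1; simp at h1; done)
    | (subst e2; simp at h2)

end Stacks

variable {P Γ : Type} [Encodable P] [Encodable Γ]

/-! ### Signature -/

/-- Concept for the nodes of a colour. -/
def colorC (P : Type) [Encodable P] (c : Color) : Concept :=
  .name (encode (.inl c : Color ⊕ Bool ⊕ P))

/-- Concept for the nodes whose stack `i` is empty. -/
def emptyC (P : Type) [Encodable P] (i : Bool) : Concept :=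
  .name (encode (.inr (.inl i) : Color ⊕ Bool ⊕ P))

/-- Concept for the nodes that are reachable in the state `p`. -/
def stateC (p : P) : Concept := .name (encode (.inr (.inr p) : Color ⊕ Bool ⊕ P))

/-- Role from a pair of stacks to the result of pushing `a` to the stack `i`. -/
def pushR (i : Bool) (a : Γ) : ℕ := encode (true, i, a)

/-- Inverse of the role `pushR`. -/
def popR (i : Bool) (a : Γ) : ℕ := encode (false, i, a)

/-- Level for the squares given by two letters and a colour. -/
def squareL (x : Γ × Γ × Color) : ℕ := encode x + 2

/-! ### Statements -/

/-- Every node has a successor along the role for pushing `a` to the stack `i`. -/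
def succStmt (P : Type) [Encodable P] (x : Bool × Γ × Color) : Stmt :=
  .ci 1 (colorC P x.2.2) (.ex (.name (pushR x.1 x.2.1)) (colorC P (x.2.2.flip x.1)))

/-- Pushing a letter to a stack keeps the other stack empty. -/
def emptyStmt (P : Type) [Encodable P] (x : Bool × Γ) : Stmt :=
  .ci 1 (.ex (.name (popR x.1 x.2)) (emptyC P (!x.1))) (emptyC P (!x.1))

/-- An open square. -/
def openSquare (P : Type) [Encodable P] (x : Γ × Γ × Color) : Query :=
  [.conc (colorC P x.2.2) 0, .role (pushR false x.1) 0 1, .role (pushR true x.2.1) 1 2,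
    .role (pushR true x.2.1) 0 3]

/-- The roles that close a square, and the inverse roles on it. -/
def closedSquare (x : Γ × Γ × Color) : Query :=
  [.role (pushR false x.1) 3 2, .role (popR false x.1) 1 0, .role (popR false x.1) 2 3,
    .role (popR true x.2.1) 3 0]

/-- The statements that close squares. -/
def squareStmts (P : Type) [Encodable P] (x : Γ × Γ × Color) : List Stmt :=
  [.ca (squareL x) (colorC P x.2.2) 1 (openSquare P x) [0, 1, 2, 3],
    .cr 1 (closedSquare x) [0, 1, 2, 3] (squareL x) (colorC P x.2.2)]

/-- The concept inclusion for an instruction. -/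
def instrStmt : Instr P Γ → Stmt
  | .nop p p' => .ci 1 (stateC p) (stateC p')
  | .push i a p p' => .ci 1 (.ex (.name (popR i a)) (stateC p)) (stateC p')
  | .pop i a p p' => .ci 1 (.ex (.name (pushR i a)) (stateC p)) (stateC p')
  | .empty i p p' => .ci 1 (.inter (stateC p) (emptyC P i)) (stateC p')

/-- Statements that make the state `p` inconsistent: objects have a single ensemble on level `0`,
hence none that has both length one and length two. -/
def haltStmts (p : P) : List Stmt :=
  [.cr 0 [.conc .top 0] [0] 1 (stateC p), .cr 0 [.conc .top 0, .conc .top 1] [0, 1] 1 (stateC p)]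

/-- The concept for the bottom node. -/
def rootC (P : Type) [Encodable P] : Concept := .inter (emptyC P false) (emptyC P true)

/-- The concept for the node with an empty first stack and the given second stack. -/
def inputC (P : Type) [Encodable P] (l : List Γ) : Concept :=
  l.foldr (fun a C => .ex (.name (popR true a)) C) (rootC P)

/-- The part of the ontology that does not depend on the input. -/
noncomputable def baseOntology [Fintype Γ] (M : List (Instr P Γ)) (halting : List P) : Ontology :=
  (Finset.univ : Finset (Bool × Γ × Color)).toList.map (succStmt P) ++
  (Finset.univ : Finset (Bool × Γ)).toList.map (emptyStmt P) ++
  (Finset.univ : Finset (Γ × Γ × Color)).toList.flatMap (squareStmts P) ++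
  M.map instrStmt ++ halting.flatMap haltStmts

/-- The ontology that expresses that no halting state is reachable from the given input. -/
noncomputable def ontology [Fintype Γ] (M : List (Instr P Γ)) (halting : List P) (p₀ : P)
    (l : List Γ) : Ontology :=
  .ci 1 (inputC P l) (stateC p₀) :: baseOntology M halting

/-- The concept whose satisfiability is to be tested. -/
def startC (P : Type) [Encodable P] : Concept := .inter (colorC P (false, false)) (rootC P)

theorem mem_ontology_iff [Fintype Γ] {M : List (Instr P Γ)} {halting : List P} {p₀ : P}
    {l : List Γ} {s : Stmt} : s ∈ ontology M halting p₀ l ↔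
      s = .ci 1 (inputC P l) (stateC p₀) ∨ (∃ x, s = succStmt (Γ := Γ) P x) ∨
      (∃ x, s = emptyStmt (Γ := Γ) P x) ∨ (∃ x, s ∈ squareStmts (Γ := Γ) P x) ∨
      (∃ I ∈ M, s = instrStmt I) ∨ ∃ p ∈ halting, s ∈ haltStmts p := by
  simp only [ontology, baseOntology, List.mem_cons, List.mem_append, List.mem_map,
    List.mem_flatMap, Finset.mem_toList, Finset.mem_univ, true_and, or_assoc, eq_comm (b := s)]

/-! ### Syntax -/

theorem inputC_isEL (l : List Γ) : (inputC P l).IsEL := by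
  induction l with
  | nil => exact ⟨trivial, trivial⟩
  | cons a l ih => exact ⟨trivial, ih⟩

theorem openSquare_isConnected (x : Γ × Γ × Color) :
    (openSquare P x).IsConnected [0, 1, 2, 3] := by
  have h01 : (openSquare P x).Linked 0 1 := ⟨pushR false x.1, .inl (by simp [openSquare])⟩
  have h12 : (openSquare P x).Linked 1 2 := ⟨pushR true x.2.1, .inl (by simp [openSquare])⟩
  have h03 : (openSquare P x).Linked 0 3 := ⟨pushR true x.2.1, .inl (by simp [openSquare])⟩
  have hsymm : ∀ {y z}, (openSquare P x).Linked y z → (openSquare P x).Linked z y :=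
    fun ⟨r, h⟩ => ⟨r, h.symm⟩
  have key : ∀ y ∈ [0, 1, 2, 3], Relation.ReflTransGen (openSquare P x).Linked 0 y ∧
      Relation.ReflTransGen (openSquare P x).Linked y 0 := by
    intro y hy
    simp only [List.mem_cons, List.not_mem_nil, or_false] at hy
    rcases hy with rfl | rfl | rfl | rfl
    · exact ⟨.refl, .refl⟩
    · exact ⟨.single h01, .single (hsymm h01)⟩
    · exact ⟨.tail (.single h01) h12, .tail (.single (hsymm h12)) (hsymm h01)⟩
    · exact ⟨.single h03, .single (hsymm h03)⟩
  exact fun y hy z hz => (key y hy).2.trans (key z hz).1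

theorem ontology_inFragment [Fintype Γ] (M : List (Instr P Γ)) (halting : List P) (p₀ : P)
    (l : List Γ) : ∀ s ∈ ontology M halting p₀ l, s.InFragment EL {Op.ca, Op.cr} := by
  intro s hs
  rcases mem_ontology_iff.1 hs with rfl | ⟨x, rfl⟩ | ⟨x, rfl⟩ | ⟨x, hs⟩ | ⟨I, _, rfl⟩ | ⟨p, _, hs⟩
  · exact ⟨inputC_isEL l, trivial⟩
  · exact ⟨trivial, trivial, trivial⟩
  · exact ⟨⟨trivial, trivial⟩, trivial⟩
  · simp only [squareStmts, List.mem_cons, List.not_mem_nil, or_false] at hs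
    rcases hs with rfl | rfl
    · refine ⟨by simp, trivial, ?_, by simp, ⟨by simp, ?_⟩, openSquare_isConnected x⟩ <;>
        simp [openSquare, Query.InBase, Atom.InBase, Atom.vars, EL, colorC, Concept.IsEL]
    · refine ⟨by simp, trivial, ?_, by simp, ⟨by simp, ?_⟩⟩ <;>
        simp [closedSquare, Query.InBase, Atom.InBase, Atom.vars]
  · cases I <;> simp [instrStmt, Stmt.InFragment, EL, Concept.IsEL, Role.IsName, stateC, emptyC]
  · simp only [haltStmts, List.mem_cons, List.not_mem_nil, or_false] at hs
    rcases hs with rfl | rfl <;>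
      simp [Stmt.InFragment, Query.InBase, Atom.InBase, Atom.vars, Query.IsFull, EL, stateC,
        Concept.IsEL]

theorem _root_.AbsDL.Concept.IsEL.isALC {C : Concept} (h : C.IsEL) : C.IsALC := by
  induction C with
  | top => trivial
  | name => trivial
  | neg => exact h.elim
  | inter C D ihC ihD => exact ⟨ihC h.1, ihD h.2⟩
  | union => exact h.elim
  | ex R C ih => exact ⟨h.1, ih h.2⟩
  | all => exact h.elim

/-- Lets the same ontology serve both fragments of the main theorem. -/
theorem _root_.AbsDL.Stmt.InFragment.mono {B B' : BaseDL} {ops ops' : Set Op} {s : Stmt}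
    (hC : ∀ C, B.concept C → B'.concept C) (hR : ∀ R, B.role R → B'.role R)
    (hI : B.roleInclusions → B'.roleInclusions) (ho : ops ⊆ ops') (h : s.InFragment B ops) :
    s.InFragment B' ops' := by
  have hq : ∀ q : Query, q.InBase B → q.InBase B' := by
    intro q hq α hα
    have := hq α hα
    cases α with
    | conc C x => exact hC _ this
    | role r x y => trivial
  cases s with
  | ci => exact ⟨hC _ h.1, hC _ h.2⟩
  | ri => exact ⟨hI h.1, hR _ h.2.1, hR _ h.2.2⟩
  | cr => exact ⟨ho h.1, hC _ h.2.1, hq _ h.2.2.1, h.2.2.2⟩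
  | ca => exact ⟨ho h.1, hC _ h.2.1, hq _ h.2.2.1, h.2.2.2⟩
  | rr => exact ⟨ho h.1, hC _ h.2.1, hR _ h.2.2.1, hC _ h.2.2.2.1, hq _ h.2.2.2.2.1, h.2.2.2.2.2⟩
  | ra => exact ⟨ho h.1, hR _ h.2.1, hq _ h.2.2.1, h.2.2.2⟩

/-! ### Queries -/

theorem mem_answers_openSquare {I : Interp} {x : Γ × Γ × Color} {es : List I.Dom} :
    es ∈ (openSquare P x).answers [0, 1, 2, 3] I ↔ ∃ d₀ d₁ d₂ d₃, es = [d₀, d₁, d₂, d₃] ∧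
      d₀ ∈ (colorC P x.2.2).ext I ∧ I.role (pushR false x.1) d₀ d₁ ∧
      I.role (pushR true x.2.1) d₁ d₂ ∧ I.role (pushR true x.2.1) d₀ d₃ := by
  constructor
  · rintro ⟨h, hh, rfl⟩
    simp only [Query.IsHom, openSquare, List.forall_mem_cons, Atom.Holds] at hh
    exact ⟨h 0, h 1, h 2, h 3, rfl, hh.1, hh.2.1, hh.2.2.1, hh.2.2.2.1⟩
  · rintro ⟨d₀, d₁, d₂, d₃, rfl, h0, h1, h2, h3⟩
    refine ⟨fun n => if n = 0 then d₀ else if n = 1 then d₁ else if n = 2 then d₂ else d₃, ?_, ?_⟩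
    · simp [Query.IsHom, openSquare, Atom.Holds, h0, h1, h2, h3]
    · simp

theorem mem_answers_closedSquare {I : Interp} {x : Γ × Γ × Color} {es : List I.Dom} :
    es ∈ (closedSquare x).answers [0, 1, 2, 3] I ↔ ∃ d₀ d₁ d₂ d₃, es = [d₀, d₁, d₂, d₃] ∧
      I.role (pushR false x.1) d₃ d₂ ∧ I.role (popR false x.1) d₁ d₀ ∧
      I.role (popR false x.1) d₂ d₃ ∧ I.role (popR true x.2.1) d₃ d₀ := by
  constructor
  · rintro ⟨h, hh, rfl⟩
    simp only [Query.IsHom, closedSquare, List.forall_mem_cons, Atom.Holds] at hh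
    exact ⟨h 0, h 1, h 2, h 3, rfl, hh.1, hh.2.1, hh.2.2.1, hh.2.2.2.1⟩
  · rintro ⟨d₀, d₁, d₂, d₃, rfl, h0, h1, h2, h3⟩
    refine ⟨fun n => if n = 0 then d₀ else if n = 1 then d₁ else if n = 2 then d₂ else d₃, ?_, ?_⟩
    · simp [Query.IsHom, closedSquare, Atom.Holds, h0, h1, h2, h3]
    · simp

end TwoStack

namespace TwoStack

open AbsDL Encodable

variable {P Γ : Type} [Encodable P] [Encodable Γ]

/-! ### Models yield the grid of all pairs of stacks -/

section Grid

variable [Inhabited Γ] {G : Interp} {d₀ : G.Dom}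
  (hsucc : ∀ i (a : Γ) c d, d ∈ (colorC P c).ext G →
    ∃ e, G.role (pushR i a) d e ∧ e ∈ (colorC P (c.flip i)).ext G)
  (hsquare : ∀ (x : Γ × Γ × Color) d₀ d₁ d₂ d₃, d₀ ∈ (colorC P x.2.2).ext G →
    G.role (pushR false x.1) d₀ d₁ → G.role (pushR true x.2.1) d₁ d₂ →
    G.role (pushR true x.2.1) d₀ d₃ →
    G.role (pushR false x.1) d₃ d₂ ∧ G.role (popR false x.1) d₁ d₀ ∧
      G.role (popR false x.1) d₂ d₃ ∧ G.role (popR true x.2.1) d₃ d₀)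
  (h₀ : d₀ ∈ (colorC P (false, false)).ext G)

-- Chosen successors give a bottom row of pushes to the first stack, and above each of its nodes a
-- tree of pushes to the second. Horizontal edges then climb by induction on the second stack:
-- closing an open square yields the edge one letter higher. The map need not be injective.
include hsucc hsquare h₀ in
theorem exists_grid : ∃ h : Stacks Γ → G.Dom, h ([], []) = d₀ ∧
    ∀ i a s, G.role (pushR i a) (h s) (h (s.push i a)) ∧
      G.role (popR i a) (h (s.push i a)) (h s) := by
  -- An object may have several colours, so a node records the colour for which its successors are
  -- chosen.
  choose f hf using fun (i : Bool) (a : Γ) (p : Σ' (c : Color) (d : G.Dom), d ∈ (colorC P c).ext G) =>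
    hsucc i a p.1 p.2.1 p.2.2
  let Node := Σ' (c : Color) (d : G.Dom), d ∈ (colorC P c).ext G
  let next (i : Bool) (a : Γ) (p : Node) : Node := ⟨p.1.flip i, f i a p, (hf i a p).2⟩
  let bottom : List Γ → Node := List.foldr (next false) ⟨_, d₀, h₀⟩
  let g : List Γ → List Γ → Node := fun u v => v.foldr (next true) (bottom u)
  have hcol : ∀ u v, (g u v).1 = Stacks.color (u, v) := by
    intro u v
    induction v with
    | nil =>
      induction u with
      | nil => exact Stacks.color_nil.symm
      | cons a u ih => exact (congrArg (Color.flip false) ih).trans (Stacks.color_push false a _).symm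
    | cons a v ih => exact (congrArg (Color.flip true) ih).trans (Stacks.color_push true a _).symm
  have hmem : ∀ u v, (g u v).2.1 ∈ (colorC P (Stacks.color (u, v))).ext G := by
    intro u v
    rw [← hcol]
    exact (g u v).2.2
  have htrue : ∀ u b v, G.role (pushR true b) (g u v).2.1 (g u (b :: v)).2.1 :=
    fun u b v => (hf true b (g u v)).1
  have hfalse : ∀ a u v, G.role (pushR false a) (g u v).2.1 (g (a :: u) v).2.1 := by
    intro a u v
    induction v with
    | nil => exact (hf false a (g u [])).1
    | cons b v ih =>
      exact (hsquare (a, b, _) _ _ _ _ (hmem u v) ih (htrue (a :: u) b v) (htrue u b v)).1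
  have hsq : ∀ a b u v, _ := fun a b u v => hsquare (a, b, _) _ _ _ _ (hmem u v) (hfalse a u v)
    (htrue (a :: u) b v) (htrue u b v)
  refine ⟨fun s => (g s.1 s.2).2.1, rfl, ?_⟩
  rintro (_ | _) a ⟨u, v⟩
  -- Inverse edges are sides of closed squares; any letter serves for the other direction.
  · exact ⟨hfalse a u v, (hsq a default u v).2.1⟩
  · exact ⟨htrue u a v, (hsq default a u v).2.2.2⟩

end Grid

theorem not_reach_of_satisfiable [Fintype Γ] [Inhabited Γ] {M : List (Instr P Γ)}
    {halting : List P} {p₀ : P} {l : List Γ}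
    (h : SatisfiableDAG (ontology M halting p₀ l) (startC P) 1) :
    ¬ ∃ p ∈ halting, ∃ s, Reach M p₀ ([], l) p s := by
  obtain ⟨I, hI, -, d₀, h₀, hF, hT⟩ := h
  have hmem : ∀ s, _ → I.Satisfies s := fun s hs => hI s (mem_ontology_iff.2 hs)
  have hsucc : ∀ i (a : Γ) c d, d ∈ (colorC P c).ext (I.interp 1) →
      ∃ e, (I.interp 1).role (pushR i a) d e ∧ e ∈ (colorC P (c.flip i)).ext (I.interp 1) :=
    fun i a c d hd => (hmem _ (.inr (.inl ⟨(i, a, c), rfl⟩))).2 hd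
  have hsquare : ∀ (x : Γ × Γ × Color) d₀ d₁ d₂ d₃, d₀ ∈ (colorC P x.2.2).ext (I.interp 1) →
      (I.interp 1).role (pushR false x.1) d₀ d₁ → (I.interp 1).role (pushR true x.2.1) d₁ d₂ →
      (I.interp 1).role (pushR true x.2.1) d₀ d₃ →
      (I.interp 1).role (pushR false x.1) d₃ d₂ ∧ (I.interp 1).role (popR false x.1) d₁ d₀ ∧
        (I.interp 1).role (popR false x.1) d₂ d₃ ∧ (I.interp 1).role (popR true x.2.1) d₃ d₀ := by
    intro x d₀ d₁ d₂ d₃ hd h1 h2 h3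
    obtain ⟨d, hd', e⟩ := (hmem (.ca (squareL x) (colorC P x.2.2) 1 (openSquare P x) [0, 1, 2, 3])
      (.inr (.inr (.inr (.inl ⟨x, by simp [squareStmts]⟩))))).2 _
      (mem_answers_openSquare.2 ⟨d₀, d₁, d₂, d₃, rfl, hd, h1, h2, h3⟩)
    obtain ⟨es, hes, e'⟩ := (hmem (.cr 1 (closedSquare x) [0, 1, 2, 3] (squareL x) (colorC P x.2.2))
      (.inr (.inr (.inr (.inl ⟨x, by simp [squareStmts]⟩))))).2 d hd'
    obtain ⟨d₀', d₁', d₂', d₃', rfl, hcl⟩ := mem_answers_closedSquare.1 hes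
    -- An object has one ensemble per level, so the refinement speaks of the very square that was
    -- abstracted.
    have := e.symm.trans e'
    simp only [Option.some_inj, List.cons.injEq, and_true] at this
    obtain ⟨rfl, rfl, rfl, rfl⟩ := this
    exact hcl
  obtain ⟨g, rfl, hg⟩ := exists_grid hsucc hsquare h₀
  have hempty : ∀ i s, s.get i = [] → g s ∈ (emptyC P i).ext (I.interp 1) := by
    have hstep : ∀ i a s, g s ∈ (emptyC P (!i)).ext (I.interp 1) →
        g (s.push i a) ∈ (emptyC P (!i)).ext (I.interp 1) := fun i a s hs =>
      (hmem _ (.inr (.inr (.inl ⟨(i, a), rfl⟩)))).2 ⟨_, (hg i a s).2, hs⟩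
    rintro (_ | _) ⟨u, v⟩ hs <;> simp only [Stacks.get, cond_true, cond_false] at hs <;> subst hs
    · induction v with
      | nil => exact hF
      | cons b v ih => exact hstep true b ([], v) ih
    · induction u with
      | nil => exact hT
      | cons a u ih => exact hstep false a (u, []) ih
  have hinput : g ([], l) ∈ (inputC P l).ext (I.interp 1) := by
    -- These mention `l` through the ontology and would obstruct the induction on `l`.
    clear hmem hI
    induction l with
    | nil => exact ⟨hF, hT⟩
    | cons a l ih => exact ⟨_, (hg true a ([], l)).2, ih⟩
  have hreach : ∀ p s, Reach M p₀ ([], l) p s → g s ∈ (stateC p).ext (I.interp 1) := by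
    have hinstr : ∀ {J}, J ∈ M → I.Satisfies (instrStmt J) := fun hJ =>
      hmem _ (.inr (.inr (.inr (.inr (.inl ⟨_, hJ, rfl⟩)))))
    intro p s hr
    induction hr with
    | refl => exact (hmem _ (.inl rfl)).2 hinput
    | nop hJ _ ih => exact (hinstr hJ).2 ih
    | push hJ _ ih => exact (hinstr hJ).2 ⟨_, (hg _ _ _).2, ih⟩
    | pop hJ _ ih => exact (hinstr hJ).2 ⟨_, (hg _ _ _).1, ih⟩
    | empty hJ hs _ ih => exact (hinstr hJ).2 ⟨ih, hempty _ _ hs⟩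
  rintro ⟨p, hp, s, hr⟩
  have hhalt : ∀ t ∈ haltStmts p, I.Satisfies t := fun t ht =>
    hmem _ (.inr (.inr (.inr (.inr (.inr ⟨p, hp, ht⟩)))))
  simp only [haltStmts, List.forall_mem_cons] at hhalt
  obtain ⟨_, ⟨f, -, rfl⟩, e₁⟩ := hhalt.1.2 _ (hreach p s hr)
  obtain ⟨_, ⟨f', -, rfl⟩, e₂⟩ := hhalt.2.1.2 _ (hreach p s hr)
  have := e₁.symm.trans e₂
  simp at this

/-! ### The intended model -/

/-- What the concept names say about a pair of stacks. -/
def NameHolds (M : List (Instr P Γ)) (p₀ : P) (s₀ s : Stacks Γ) : Color ⊕ Bool ⊕ P → Prop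
  | .inl c => s.color = c
  | .inr (.inl i) => s.get i = []
  | .inr (.inr p) => Reach M p₀ s₀ p s

/-- The grid of all pairs of stacks. -/
def gridInterp (M : List (Instr P Γ)) (p₀ : P) (s₀ : Stacks Γ) : Interp where
  Dom := Stacks Γ
  nonempty := ⟨([], [])⟩
  conc n := {s | ∃ x, encode x = n ∧ NameHolds M p₀ s₀ s x}
  role n s t := ∃ i a, (n = pushR i a ∧ t = s.push i a) ∨ (n = popR i a ∧ s = t.push i a)

/-- The ensemble on level `L` of a pair of stacks on level `L'`: a square if there is one for this
level and colour. -/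
def squareAt (L' : ℕ) (s : Stacks Γ) (L : ℕ) : Option (List (Stacks Γ)) :=
  if L = 1 ∧ 2 ≤ L' then
    (decode (L' - 2) : Option (Γ × Γ × Color)).bind fun x =>
      if s.color = x.2.2 then some (s.square x.1 x.2.1) else none
  else none

theorem squareAt_eq_some {L' L : ℕ} {s : Stacks Γ} {es : List (Stacks Γ)} :
    squareAt L' s L = some es ↔ (L = 1 ∧ 2 ≤ L') ∧ ∃ x : Γ × Γ × Color,
      decode (L' - 2) = some x ∧ s.color = x.2.2 ∧ es = s.square x.1 x.2.1 := by
  simp only [squareAt, Option.bind_eq_some_iff, Option.ite_none_right_eq_some, Option.some_inj,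
    eq_comm (a := es)]

/-- The intended model. -/
def model (M : List (Instr P Γ)) (p₀ : P) (s₀ : Stacks Γ) : DAGInterp where
  levels := Set.univ
  prec L L' := L < L'
  prec_mem _ _ _ := ⟨trivial, trivial⟩
  acyclic L h := by
    rw [Relation.transGen_eq_self] at h
    exact lt_irrefl L h
  -- Each level is a copy of the grid, so a square can be represented by its own lower left corner.
  interp _ := gridInterp M p₀ s₀
  rho L' s L := squareAt L' s L
  rho_prec L' s L h := by
    obtain ⟨es, he⟩ := Option.isSome_iff_exists.1 h
    obtain ⟨⟨rfl, hL⟩, -⟩ := squareAt_eq_some.1 he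
    exact hL
  rho_ne_nil L' s L es h := by
    obtain ⟨-, x, -, -, rfl⟩ := squareAt_eq_some.1 h
    exact List.cons_ne_nil _ _
  rho_unique L L' d e₁ e₂ es₁ es₂ h₁ h₂ hd₁ hd₂ := by
    obtain ⟨-, x, hx, hc, rfl⟩ := squareAt_eq_some.1 h₁
    obtain ⟨-, x', hx', hc', rfl⟩ := squareAt_eq_some.1 h₂
    -- The coarser level determines letters and colour, so both squares have the same ones.
    obtain rfl := Option.some_inj.1 (hx.symm.trans hx')
    exact Stacks.eq_of_mem_square (hc.trans hc'.symm) hd₁ hd₂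

section Model

variable {M : List (Instr P Γ)} {p₀ : P} {s₀ s t : Stacks Γ}

theorem model_rho_squareL (x : Γ × Γ × Color) (hs : s.color = x.2.2) :
    (model M p₀ s₀).rho (squareL x) s 1 = some (s.square x.1 x.2.1) := by
  have h : squareAt (squareL x) s 1 = some (s.square x.1 x.2.1) :=
    squareAt_eq_some.2 ⟨⟨rfl, Nat.le_add_left 2 _⟩, x, encodek x, hs, rfl⟩
  exact h

theorem mem_ext_name (x : Color ⊕ Bool ⊕ P) :
    s ∈ (Concept.name (encode x)).ext (gridInterp M p₀ s₀) ↔ NameHolds M p₀ s₀ s x := by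
  constructor
  · rintro ⟨y, hy, h⟩
    rwa [← encode_injective hy]
  · exact fun h => ⟨x, rfl, h⟩

theorem mem_ext_colorC {c : Color} :
    s ∈ (colorC P c).ext (gridInterp M p₀ s₀) ↔ s.color = c := mem_ext_name _

theorem mem_ext_emptyC {i : Bool} :
    s ∈ (emptyC P i).ext (gridInterp M p₀ s₀) ↔ s.get i = [] := mem_ext_name _

theorem mem_ext_stateC {p : P} :
    s ∈ (stateC p).ext (gridInterp M p₀ s₀) ↔ Reach M p₀ s₀ p s := mem_ext_name _

theorem gridInterp_pushR {i : Bool} {a : Γ} :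
    (gridInterp M p₀ s₀).role (pushR i a) s t ↔ t = s.push i a := by
  constructor
  · rintro ⟨j, b, ⟨h, e⟩ | ⟨h, e⟩⟩ <;> simp [pushR, popR, -encode_prod_val] at h
    obtain ⟨rfl, rfl⟩ := h
    exact e
  · exact fun h => ⟨i, a, .inl ⟨rfl, h⟩⟩

theorem gridInterp_popR {i : Bool} {a : Γ} :
    (gridInterp M p₀ s₀).role (popR i a) s t ↔ s = t.push i a := by
  constructor
  · rintro ⟨j, b, ⟨h, e⟩ | ⟨h, e⟩⟩ <;> simp [pushR, popR, -encode_prod_val] at h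
    obtain ⟨rfl, rfl⟩ := h
    exact e
  · exact fun h => ⟨i, a, .inr ⟨rfl, h⟩⟩

theorem mem_ext_ex_pushR {i : Bool} {a : Γ} {C : Concept} :
    s ∈ (Concept.ex (.name (pushR i a)) C).ext (gridInterp M p₀ s₀) ↔
      s.push i a ∈ C.ext (gridInterp M p₀ s₀) := by
  constructor
  · rintro ⟨t, h, ht⟩
    rwa [← gridInterp_pushR.1 h]
  · exact fun h => ⟨_, gridInterp_pushR.2 rfl, h⟩

theorem mem_ext_ex_popR {i : Bool} {a : Γ} {C : Concept} :
    s ∈ (Concept.ex (.name (popR i a)) C).ext (gridInterp M p₀ s₀) ↔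
      ∃ t, s = t.push i a ∧ t ∈ C.ext (gridInterp M p₀ s₀) :=
  exists_congr fun _ => and_congr_left fun _ => gridInterp_popR

theorem mem_ext_inputC {l : List Γ} :
    s ∈ (inputC P l).ext (gridInterp M p₀ s₀) ↔ s = ([], l) := by
  induction l generalizing s with
  | nil =>
    refine (and_congr mem_ext_emptyC mem_ext_emptyC).trans ?_
    simp [Stacks.get, Prod.ext_iff]
  | cons a l ih =>
    refine mem_ext_ex_popR.trans ?_
    refine (exists_congr fun t => and_congr_right fun _ => ih).trans ?_
    exact ⟨fun ⟨t, h, e⟩ => h.trans (congrArg (Stacks.push true a) e), fun h => ⟨([], l), h, rfl⟩⟩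

end Model

/-- State concepts are interpreted by exact reachability, so each instruction inclusion is a closure
rule of `Reach`. Halting concepts are empty, which makes the contradictory refinements to level 0
vacuous. -/
theorem satisfiable_of_not_reach [Fintype Γ] {M : List (Instr P Γ)} {halting : List P} {p₀ : P}
    {l : List Γ} (h : ¬ ∃ p ∈ halting, ∃ s, Reach M p₀ ([], l) p s) :
    SatisfiableDAG (ontology M halting p₀ l) (startC P) 1 := by
  refine ⟨model M p₀ ([], l), fun s hs => ?_, trivial, (([], []) : Stacks Γ),
    mem_ext_colorC.2 Stacks.color_nil, mem_ext_emptyC.2 (by rfl), mem_ext_emptyC.2 (by rfl)⟩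
  rcases mem_ontology_iff.1 hs with rfl | ⟨x, rfl⟩ | ⟨x, rfl⟩ | ⟨x, hs⟩ | ⟨I, hI, rfl⟩ | ⟨p, hp, hs⟩
  · refine ⟨trivial, fun s hs => mem_ext_stateC.2 ?_⟩
    obtain rfl := mem_ext_inputC.1 hs
    exact .refl
  · refine ⟨trivial, fun s hs => mem_ext_ex_pushR.2 (mem_ext_colorC.2 ?_)⟩
    exact (Stacks.color_push _ _ _).trans (congrArg (Color.flip x.1) (mem_ext_colorC.1 hs))
  · refine ⟨trivial, fun s hs => mem_ext_emptyC.2 ?_⟩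
    obtain ⟨t, rfl, ht⟩ := mem_ext_ex_popR.1 hs
    exact (Stacks.get_push_not _ _ _).trans (mem_ext_emptyC.1 ht)
  · have hlt : 1 < squareL x := by simp [squareL]
    simp only [squareStmts, List.mem_cons, List.not_mem_nil, or_false] at hs
    rcases hs with rfl | rfl
    · refine ⟨hlt, fun es hes => ?_⟩
      obtain ⟨d₀, d₁, d₂, d₃, rfl, h0, h1, h2, h3⟩ := mem_answers_openSquare.1 hes
      -- Push roles are functional in the grid, so every answer is a genuine square.
      obtain rfl := gridInterp_pushR.1 h1
      obtain rfl := gridInterp_pushR.1 h2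
      obtain rfl := gridInterp_pushR.1 h3
      exact ⟨d₀, h0, model_rho_squareL x (mem_ext_colorC.1 h0)⟩
    · refine ⟨hlt, fun s hs => ⟨_, ?_, model_rho_squareL x (mem_ext_colorC.1 hs)⟩⟩
      -- The first `rfl` is where pushes to different stacks commute.
      exact mem_answers_closedSquare.2 ⟨_, _, _, _, rfl, gridInterp_pushR.2 rfl,
        gridInterp_popR.2 rfl, gridInterp_popR.2 rfl, gridInterp_popR.2 rfl⟩
  · cases I with
    | nop p p' => exact ⟨trivial, fun s hs => mem_ext_stateC.2 (.nop hI (mem_ext_stateC.1 hs))⟩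
    | push i a p p' =>
      refine ⟨trivial, fun s hs => mem_ext_stateC.2 ?_⟩
      obtain ⟨t, rfl, ht⟩ := mem_ext_ex_popR.1 hs
      exact .push hI (mem_ext_stateC.1 ht)
    | pop i a p p' =>
      exact ⟨trivial, fun s hs =>
        mem_ext_stateC.2 (.pop hI (mem_ext_stateC.1 (mem_ext_ex_pushR.1 hs)))⟩
    | empty i p p' =>
      exact ⟨trivial, fun s hs =>
        mem_ext_stateC.2 (.empty hI (mem_ext_emptyC.1 hs.2) (mem_ext_stateC.1 hs.1))⟩
  · have hn : ∀ s, s ∉ (stateC p).ext (gridInterp M p₀ ([], l)) :=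
      fun s hs => h ⟨p, hp, s, mem_ext_stateC.1 hs⟩
    simp only [haltStmts, List.mem_cons, List.not_mem_nil, or_false] at hs
    rcases hs with rfl | rfl <;>
      exact ⟨Nat.zero_lt_one, fun s hs => (hn s hs).elim⟩

theorem satisfiable_ontology_iff [Fintype Γ] [Inhabited Γ] (M : List (Instr P Γ))
    (halting : List P) (p₀ : P) (l : List Γ) :
    SatisfiableDAG (ontology M halting p₀ l) (startC P) 1 ↔
      ¬ ∃ p ∈ halting, ∃ s, Reach M p₀ ([], l) p s :=
  ⟨not_reach_of_satisfiable, satisfiable_of_not_reach⟩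

end TwoStack

/-! ## Computability of the reduction -/

namespace AbsDL

open Encodable

/-- On Gödel numbers this is pairing and arithmetic. -/
theorem primrec_ex_name : Primrec₂ fun (r : ℕ) (C : Concept) => Concept.ex (.name r) C := by
  have hr : Primrec fun r : ℕ => Role.name r := by
    refine Primrec.encode_iff.1 ?_
    exact (Primrec.encode.comp (Primrec.sumInl (α := ℕ) (β := ℕ))).of_eq fun r => rfl
  refine Primrec.encode_iff.1 ?_
  have : Primrec fun p : ℕ × Concept => 6 * Nat.pair (encode (Role.name p.1)) (encode p.2) + 5 :=
    Primrec.nat_add.comp (Primrec.nat_mul.comp (Primrec.const 6)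
      (Primrec₂.natPair.comp (Primrec.encode.comp (hr.comp Primrec.fst))
        (Primrec.encode.comp Primrec.snd))) (Primrec.const 5)
  exact this.of_eq fun p => rfl

theorem primrec_ci (L : ℕ) (D : Concept) : Primrec fun C : Concept => Stmt.ci L C D := by
  refine Primrec.encode_iff.1 ?_
  have : Primrec fun C : Concept => Stmt.equivSum (Stmt.ci L C D) :=
    Primrec.sumInl.comp (Primrec.pair (Primrec.const L) (Primrec.pair Primrec.id (Primrec.const D)))
  exact (Primrec.encode.comp this).of_eq fun C => rfl

end AbsDL

namespace TwoStack

open AbsDL Encodable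

/-- `Γ` carries no computability structure; its letters enter only through the role names `popR true
a`, so the fold can run over natural numbers. -/
theorem computable_inputC {P Γ : Type} [Encodable P] [Encodable Γ] {inp : ℕ → List Γ}
    (h : ∀ e : Γ → ℕ, Computable fun n => (inp n).map e) :
    Computable fun n => inputC P (inp n) := by
  have hf : Primrec fun l : List ℕ => l.foldr (fun r C => Concept.ex (.name r) C) (rootC P) :=
    Primrec.list_foldr Primrec.id (Primrec.const _) (primrec_ex_name.comp
      (Primrec.fst.comp Primrec.snd) (Primrec.snd.comp Primrec.snd)).to₂
  refine (hf.to_comp.comp (h (popR true))).of_eq fun n => ?_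
  rw [List.foldr_map]
  rfl

/-- Only the first inclusion varies with `n`. The rest is a constant, so its noncomputable
enumerations are harmless. -/
theorem computable_input {P Γ : Type} [Encodable P] [Encodable Γ] [Fintype Γ]
    (M : List (Instr P Γ)) (halting : List P) (p₀ : P) {inp : ℕ → List Γ}
    (h : ∀ e : Γ → ℕ, Computable fun n => (inp n).map e) :
    Computable fun n => ((ontology M halting p₀ (inp n), startC P, 1) : Input) :=
  Computable.pair (Computable.list_cons.comp
    ((primrec_ci 1 (stateC p₀)).to_comp.comp (computable_inputC h)) (Computable.const _))
    (Computable.const _)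

/-- Undecidability holds for all fragments that contain `EL^abs[ca,cr]`. -/
theorem not_dagSatDecidable {B : BaseDL} {ops : Set Op} (hC : ∀ C, C.IsEL → B.concept C)
    (hR : ∀ R, R.IsName → B.role R) (hops : {Op.ca, Op.cr} ⊆ ops) : ¬ DAGSatDecidable B ops := by
  rintro ⟨f, hf, hfs⟩
  obtain ⟨Γ, Λ, _, _, _, _, M, inp, hinp, hM⟩ := Turing.exists_TM0_halting_undecidable
  let _ : Encodable Γ := Encodable.ofCountable Γ
  let _ : Encodable Λ := Encodable.ofCountable Λ
  refine hM (ComputablePred.computable_iff.2 ⟨fun n =>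
    -- Satisfiability means non-halting, hence the negation.
    !f (ontology (sim M) (simHalting M) (default, .inr true) (inp n), startC (SimState Γ Λ), 1),
    Primrec.not.to_comp.comp (hf.comp (computable_input _ _ _ hinp)), ?_⟩)
  funext n
  have h := hfs (ontology (sim M) (simHalting M) (default, .inr true) (inp n),
    startC (SimState Γ Λ), 1) ⟨fun s hs => (ontology_inFragment _ _ _ _ s hs).mono hC hR
      False.elim hops, hC _ ⟨trivial, trivial, trivial⟩⟩
  rw [satisfiable_ontology_iff, ← eval_dom_iff_reach] at h
  rw [eq_iff_iff, Bool.not_eq_true', ← Bool.not_eq_true, h, not_not]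

end TwoStack

theorem theorem7 :
    ¬ AbsDL.DAGSatDecidable AbsDL.ALC {AbsDL.Op.ca, AbsDL.Op.cr} ∧
    ¬ AbsDL.DAGSatDecidable AbsDL.EL {AbsDL.Op.ca, AbsDL.Op.cr, AbsDL.Op.rr} := by
  refine ⟨TwoStack.not_dagSatDecidable (fun _ h => h.isALC) (fun _ h => h) subset_rfl,
    TwoStack.not_dagSatDecidable (fun _ h => h) (fun _ h => h) ?_⟩
  intro o ho
  rcases ho with rfl | rfl <;> simp
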